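/- Let $S$ be a finite set. A cellular automaton (CA) over $S$ is a map $f:S^{\mathbb Z}\to S^{\mathbb Z}$ for which there are an integer $r\ge 0$ and a local rule $g:S^{2r+1}\to S$ with $f(x)_i=g(x_{i-r},\dots,x_{i+r})$ for all $x\in S^{\mathbb Z}$ and $i\in\mathbb Z$. It is left-closing if $f(y)\neq f(y')$ for any two different configurations $y,y'\in S^{\mathbb Z}$ that are right-asymptotic, i.e. that agree on $[i,\infty)$ for some $i\in\mathbb Z$. For a positive integer $m$, an integer $i$, a right-infinite word $y\in S^{[i+3m,\infty)}$ and a left-infinite word $z\in S^{(-\infty,i)}$, a right stair of length $3m$ connecting $(y,z)$ is a pair of words $(v,w)\in S^{2m}\times S^{2m}$ for which there is a configuration $x\in S^{\mathbb Z}$ such that $x|_{[i+m,\infty)}=vy$ and $f(x)|_{(-\infty,i+2m)}=zw$. Let $\Psi_{3m}$ be the set of all right stairs of length $3m$, i.e. the union over all $i$, $y$ and $z$ of the sets of right stairs of length $3m$ connecting $(y,z)$. **Lemma.** Let $f$ be a left-closing CA over $S$. Then for all sufficiently large $n$ of the form $n=3m$, the number $|\Psi_{n}|$ divides some power of $|S|$;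 that is, there is $M$ such that for every $m\ge M$ there is $k\in\mathbb N$ with $|\Psi_{3m}|\mid |S|^{k}$. -/

import Mathlib

/-- A map on bi-infinite configurations over `S` is a (one-dimensional) cellular automaton if it is
given by a local rule `g` of some neighborhood radius `r`: the new state of cell `i` is obtained by
applying `g` to the word `x_{i-r} ... x_{i+r}`. -/
def IsCellularAutomaton {S : Type*} (f : (ℤ → S) → (ℤ → S)) : Prop :=
  ∃ (r : ℕ) (g : (Fin (2 * r + 1) → S) → S),
    ∀ (x : ℤ → S) (i : ℤ), f x i = g (fun j => x (i - (r : ℤ) + ((j : ℕ) : ℤ)))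

/-- Two configurations are right-asymptotic if they agree on some right half-line `[i, ∞)`. -/
def RightAsymptotic {S : Type*} (y y' : ℤ → S) : Prop :=
  ∃ i : ℤ, ∀ j : ℤ, i ≤ j → y j = y' j

/-- Any two different right-asymptotic configurations have different images. -/
def IsLeftClosing {S : Type*} (f : (ℤ → S) → (ℤ → S)) : Prop :=
  ∀ y y' : ℤ → S, y ≠ y' → RightAsymptotic y y' → f y ≠ f y'

/-- The configuration `x` confirms at position `i` that the pair of words `(v, w)`, each of length
`2m`, is a right stair (of length `3m`) connecting `(y, z)`, where `y` is a right-infinite word on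
`[i + 3m, ∞)` and `z` is a left-infinite word on `(-∞, i)`: the restriction of `x` to
`[i + m, ∞)` is `v y`, and the restriction of `f x` to `(-∞, i + 2m)` is `z w`. -/
structure Confirms {S : Type*} (f : (ℤ → S) → (ℤ → S)) (m : ℕ) (i : ℤ)
    (y : Set.Ici (i + 3 * (m : ℤ)) → S) (z : Set.Iio i → S)
    (v w : Fin (2 * m) → S) (x : ℤ → S) : Prop where
  eq_v : ∀ j : Fin (2 * m), x (i + (m : ℤ) + ((j : ℕ) : ℤ)) = v j
  eq_y : ∀ j : Set.Ici (i + 3 * (m : ℤ)), x j = y j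
  eq_z : ∀ j : Set.Iio i, f x j = z j
  eq_w : ∀ j : Fin (2 * m), f x (i + ((j : ℕ) : ℤ)) = w j

/-- `Ψ_{3m}(y, z)`: the set of all right stairs of length `3m` connecting `(y, z)`. -/
def rightStairsConnecting {S : Type*} (f : (ℤ → S) → (ℤ → S)) (m : ℕ) (i : ℤ)
    (y : Set.Ici (i + 3 * (m : ℤ)) → S) (z : Set.Iio i → S) :
    Set ((Fin (2 * m) → S) × (Fin (2 * m) → S)) :=
  {p | ∃ x : ℤ → S, Confirms f m i y z p.1 p.2 x}

/-- `Ψ_{3m}`: the set of all right stairs of length `3m`, i.e. the union of `Ψ_{3m}(y, z)` over all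
half-infinite words `y` and `z` (at all positions `i`). -/
def rightStairs {S : Type*} (f : (ℤ → S) → (ℤ → S)) (m : ℕ) :
    Set ((Fin (2 * m) → S) × (Fin (2 * m) → S)) :=
  ⋃ (i : ℤ) (y : Set.Ici (i + 3 * (m : ℤ)) → S) (z : Set.Iio i → S),
    rightStairsConnecting f m i y z

/-! Fix m large and weigh each stair by the number of words on `[-r, 3m)` that show it at position
0. Prepending a letter to such a word gives |S| times as many words; sorting them by the stair one
cell further left bounds |S| · weight(p) by the total weight of the left successors of p.
Left-closing, made uniform by compactness, leaves p at most |S| successors, so a stair of maximal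
weight has only successors of maximal weight. Every stair is reachable leftwards from every other,
so all weights equal some w, and |Ψ| · w = |S|^(3m+r). -/

section Stairs

variable {S : Type*}

/-- The right stair that the configuration `x` shows at position `i`. -/
def stairAt (f : (ℤ → S) → (ℤ → S)) (m : ℕ) (i : ℤ) (x : ℤ → S) :
    (Fin (2 * m) → S) × (Fin (2 * m) → S) :=
  (fun j => x (i + (m : ℤ) + ((j : ℕ) : ℤ)), fun j => f x (i + ((j : ℕ) : ℤ)))

/-- `f` is a sliding block code of radius `r`. -/
def HasRadius (f : (ℤ → S) → (ℤ → S)) (r : ℕ) : Prop :=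
  ∀ (x x' : ℤ → S) (i i' : ℤ),
    (∀ t : ℤ, -(r : ℤ) ≤ t → t ≤ r → x (i + t) = x' (i' + t)) → f x i = f x' i'

theorem IsCellularAutomaton.exists_hasRadius {f : (ℤ → S) → (ℤ → S)}
    (hf : IsCellularAutomaton f) : ∃ r, HasRadius f r := by
  obtain ⟨r, g, h⟩ := hf
  refine ⟨r, fun x x' i i' hx => ?_⟩
  rw [h, h]
  congr 1
  funext j
  have hj := j.2
  have := hx (-(r : ℤ) + ((j : ℕ) : ℤ)) (by omega) (by omega)
  simpa [sub_eq_add_neg, add_assoc] using this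

namespace HasRadius

variable {f : (ℤ → S) → (ℤ → S)} {r : ℕ}

theorem map_shift (hr : HasRadius f r) (x : ℤ → S) (c i : ℤ) :
    f (fun j => x (j + c)) i = f x (i + c) :=
  hr _ _ _ _ fun t _ _ => by congr 1; ring

theorem stairAt_shift (hr : HasRadius f r) (m : ℕ) (x : ℤ → S) (c i : ℤ) :
    stairAt f m i (fun j => x (j + c)) = stairAt f m (i + c) x := by
  unfold stairAt
  simp only [hr.map_shift]
  congr 1
  · funext j; congr 1; ring
  · funext j; congr 1; ring

/-- The image word ends at `i + 2m - 1`, so with `r ≤ m` its right dependence stays inside the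
window of the stair. -/
theorem stairAt_congr (hr : HasRadius f r) {m : ℕ} (hm : r ≤ m) {x x' : ℤ → S} {i i' : ℤ}
    (h : ∀ t : ℤ, -(r : ℤ) ≤ t → t < 3 * m → x (i + t) = x' (i' + t)) :
    stairAt f m i x = stairAt f m i' x' := by
  refine Prod.ext (funext fun j => ?_) (funext fun j => ?_)
  · have := j.2
    have := h (m + ((j : ℕ) : ℤ)) (by omega) (by omega)
    simpa [stairAt, add_assoc] using this
  · have := j.2
    refine hr _ _ _ _ fun t _ _ => ?_
    have := h (((j : ℕ) : ℤ) + t) (by omega) (by omega)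
    simpa [add_assoc] using this

theorem rightStairs_eq_range (hr : HasRadius f r) (m : ℕ) :
    rightStairs f m = Set.range (stairAt f m 0) := by
  ext p
  simp only [rightStairs, rightStairsConnecting, Set.mem_iUnion, Set.mem_ofPred_eq, Set.mem_range]
  constructor
  · rintro ⟨i, y, z, x, hx⟩
    refine ⟨fun j => x (j + i), ?_⟩
    rw [hr.stairAt_shift, zero_add]
    exact Prod.ext (funext hx.eq_v) (funext hx.eq_w)
  · rintro ⟨x, rfl⟩
    exact ⟨0, fun j => x j, fun j => f x j, x, fun _ => rfl, fun _ => rfl, fun _ => rfl,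
      fun _ => rfl⟩

theorem continuous [TopologicalSpace S] [DiscreteTopology S] (hr : HasRadius f r) :
    Continuous f := by
  refine continuous_pi fun i => continuous_discrete_rng.2 fun s => ?_
  rw [isOpen_iff_mem_nhds]
  intro x hx
  have hU : ∀ᶠ x' in nhds x, ∀ t ∈ Finset.Icc (-(r : ℤ)) r, x' (i + t) = x (i + t) := by
    rw [Filter.eventually_all_finset]
    intro t _
    exact (continuous_apply (i + t)).continuousAt.eventually_mem
      ((isOpen_discrete ({x (i + t)} : Set S)).mem_nhds rfl)
  filter_upwards [hU] with x' hx'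
  have : f x' i = f x i := hr _ _ _ _ fun t h₁ h₂ => hx' t (Finset.mem_Icc.2 ⟨h₁, h₂⟩)
  simp only [Set.mem_preimage, Set.mem_singleton_iff] at hx ⊢
  rw [this, hx]

/-- Uniform left-closing: over a finite alphabet, a stair and the next image letter on the left
determine the next letter of the configuration. -/
theorem exists_uniform_closing [Finite S] (hr : HasRadius f r) (hlc : IsLeftClosing f) :
    ∃ M : ℕ, ∀ m, M ≤ m → ∀ x x' : ℤ → S,
      stairAt f m 1 x = stairAt f m 1 x' → f x 0 = f x' 0 → x m = x' m := by
  let _ : TopologicalSpace S := ⊥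
  have : DiscreteTopology S := ⟨rfl⟩
  have hc := hr.continuous
  -- Counterexamples at scale m, translated so that cell m becomes cell 0. A pair in all of these
  -- nested compact sets would contradict left-closing.
  let K : ℕ → Set ((ℤ → S) × (ℤ → S)) := fun m =>
    {q | q.1 0 ≠ q.2 0 ∧ (∀ j : ℤ, 1 ≤ j → j ≤ 2 * m → q.1 j = q.2 j) ∧
      ∀ j : ℤ, -(m : ℤ) ≤ j → j ≤ m → f q.1 j = f q.2 j}
  have hKc : ∀ m, IsClosed (K m) := by
    intro m
    have h₀ : IsClosed {q : (ℤ → S) × (ℤ → S) | q.1 0 ≠ q.2 0} :=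
      (isClosed_discrete {s : S × S | s.1 ≠ s.2}).preimage
        (f := fun q : (ℤ → S) × (ℤ → S) => (q.1 0, q.2 0)) (by fun_prop)
    have h₁ : IsClosed {q : (ℤ → S) × (ℤ → S) |
        ∀ j : ℤ, 1 ≤ j → j ≤ 2 * m → q.1 j = q.2 j} := by
      simp only [Set.ofPred_forall]
      refine isClosed_iInter fun j => isClosed_iInter fun _ => isClosed_iInter fun _ => ?_
      exact isClosed_eq (by fun_prop) (by fun_prop)
    have h₂ : IsClosed {q : (ℤ → S) × (ℤ → S) |
        ∀ j : ℤ, -(m : ℤ) ≤ j → j ≤ m → f q.1 j = f q.2 j} := by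
      simp only [Set.ofPred_forall]
      refine isClosed_iInter fun j => isClosed_iInter fun _ => isClosed_iInter fun _ => ?_
      exact isClosed_eq ((continuous_apply j).comp (hc.comp continuous_fst))
        ((continuous_apply j).comp (hc.comp continuous_snd))
    exact h₀.inter (h₁.inter h₂)
  have hKe : ∃ M, ¬ (K M).Nonempty := by
    by_contra! hne
    obtain ⟨q, hq⟩ := IsCompact.nonempty_iInter_of_sequence_nonempty_isCompact_isClosed K
      (fun m q hq => ⟨hq.1, fun j h₁ h₂ => hq.2.1 j h₁ (by push_cast; omega),
        fun j h₁ h₂ => hq.2.2 j (by push_cast; omega) (by push_cast; omega)⟩)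
      hne (hKc 0).isCompact hKc
    rw [Set.mem_iInter] at hq
    refine hlc q.1 q.2 (fun h => (hq 0).1 (by rw [h]))
      ⟨1, fun j hj => (hq j.natAbs).2.1 j hj (by omega)⟩ (funext fun j => ?_)
    exact (hq j.natAbs).2.2 j (by omega) (by omega)
  obtain ⟨M, hM⟩ := hKe
  refine ⟨M, fun m hm x x' hst h0 => ?_⟩
  by_contra hne
  refine hM ⟨(fun j => x (j + m), fun j => x' (j + m)), by simpa using hne, fun j h₁ h₂ => ?_,
    fun j h₁ h₂ => ?_⟩
  · have := congrFun (congrArg Prod.fst hst) ⟨(j - 1).toNat, by omega⟩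
    simp only [stairAt] at this
    rwa [show (1 : ℤ) + m + ((j - 1).toNat : ℤ) = j + m by omega] at this
  · simp only [hr.map_shift]
    rcases eq_or_ne (j + m) 0 with h | h
    · rwa [h]
    · have := congrFun (congrArg Prod.snd hst) ⟨(j + m - 1).toNat, by omega⟩
      simp only [stairAt] at this
      rwa [show (1 : ℤ) + ((j + m - 1).toNat : ℤ) = j + m by omega] at this

end HasRadius

/-! ### Counting the words that show a stair -/

/-- A configuration that carries the word `u` on `[-r, k - r)`. -/
def wordConfig (s : S) (r : ℕ) {k : ℕ} (u : Fin k → S) : ℤ → S := fun j =>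
  if h : (j + r).toNat < k then u ⟨(j + r).toNat, h⟩ else s

theorem wordConfig_of_eq (s : S) {r k : ℕ} (u : Fin k → S) {j : ℤ} {n : ℕ} (hn : n < k)
    (h : j + r = n) : wordConfig s r u j = u ⟨n, hn⟩ := by
  have h' : (j + r).toNat = n := by omega
  subst h'
  simp [wordConfig, hn]

open Classical in
/-- The number of words on `[-r, 3m)` that show the stair `p` at position `0`. -/
noncomputable def stairWeight [Fintype S] (f : (ℤ → S) → (ℤ → S)) (s : S) (r m : ℕ)
    (p : (Fin (2 * m) → S) × (Fin (2 * m) → S)) : ℕ :=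
  (Finset.univ.filter fun u : Fin (3 * m + r) → S =>
    stairAt f m 0 (wordConfig s r u) = p).card

/-- The stairs that can occur one cell to the left of the stair `p`. -/
def leftSuccessors (f : (ℤ → S) → (ℤ → S)) (m : ℕ)
    (p : (Fin (2 * m) → S) × (Fin (2 * m) → S)) :
    Set ((Fin (2 * m) → S) × (Fin (2 * m) → S)) :=
  {q | ∃ x, stairAt f m 1 x = p ∧ stairAt f m 0 x = q}

variable {f : (ℤ → S) → (ℤ → S)} {r m : ℕ}

theorem HasRadius.stairAt_wordConfig_cons (hr : HasRadius f r) (hm : r ≤ m) (s c : S)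
    (u : Fin (3 * m + r) → S) :
    stairAt f m 1 (wordConfig s r (Fin.cons c u : Fin (3 * m + r + 1) → S)) =
      stairAt f m 0 (wordConfig s r u) := by
  refine hr.stairAt_congr hm fun t h₁ h₂ => ?_
  rw [wordConfig_of_eq s u (n := (t + r).toNat) (by omega) (by omega),
    wordConfig_of_eq s _ (n := (t + r).toNat + 1) (by omega) (by omega)]
  exact Fin.cons_succ (α := fun _ => S) c u ⟨(t + r).toNat, by omega⟩

theorem HasRadius.stairAt_wordConfig_init (hr : HasRadius f r) (hm : r ≤ m) (s : S)
    (u : Fin (3 * m + r + 1) → S) :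
    stairAt f m 0 (wordConfig s r (Fin.init u : Fin (3 * m + r) → S)) =
      stairAt f m 0 (wordConfig s r u) := by
  refine hr.stairAt_congr hm fun t h₁ h₂ => ?_
  rw [wordConfig_of_eq s u (n := (t + r).toNat) (by omega) (by omega),
    wordConfig_of_eq s _ (n := (t + r).toNat) (by omega) (by omega)]
  rfl

-- Double counting of words on `[-r, 3m]` whose stair at position 1 is `p`: deleting the first
-- letter gives the left side, deleting the last the right side.
open Classical in
theorem HasRadius.card_mul_stairWeight_le [Fintype S] (hr : HasRadius f r) (hm : r < m) (s : S)
    (p : (Fin (2 * m) → S) × (Fin (2 * m) → S)) :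
    Fintype.card S * stairWeight f s r m p ≤
      ∑ q ∈ (leftSuccessors f m p).toFinset, stairWeight f s r m q := by
  set W := Finset.univ.filter fun u : Fin (3 * m + r + 1) → S =>
    stairAt f m 1 (wordConfig s r u) = p with hW
  have h₁ : Fintype.card S * stairWeight f s r m p ≤ W.card := by
    rw [stairWeight, ← Finset.card_univ, ← Finset.card_product]
    refine Finset.card_le_card_of_injOn
      (fun q => (Fin.cons q.1 q.2 : Fin (3 * m + r + 1) → S)) ?_ ?_
    · intro q hq
      simp only [Finset.coe_product, Set.mem_prod, Finset.mem_coe, Finset.mem_filter,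
        Finset.mem_univ, true_and] at hq
      simp only [hW, Finset.mem_coe, Finset.mem_filter, Finset.mem_univ, true_and]
      rw [hr.stairAt_wordConfig_cons hm.le, hq]
    · intro q _ q' _ h
      exact Prod.ext (Fin.cons_injective2 h).1 (Fin.cons_injective2 h).2
  refine h₁.trans ?_
  rw [Finset.card_eq_sum_card_fiberwise (f := fun u => stairAt f m 0 (wordConfig s r u))
    (t := (leftSuccessors f m p).toFinset)]
  · refine Finset.sum_le_sum fun q _ => ?_
    refine Finset.card_le_card_of_injOn
      (fun u => (Fin.init u : Fin (3 * m + r) → S)) ?_ ?_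
    · intro u hu
      simp only [Finset.coe_filter, Set.mem_ofPred_eq] at hu
      simp only [Finset.mem_coe, Finset.mem_filter, Finset.mem_univ, true_and]
      rw [hr.stairAt_wordConfig_init hm.le, hu.2]
    · intro u hu u' hu' h
      -- Deleting the last letter loses nothing: cell 3m is the last cell of the upper word of `p`.
      have hlast : ∀ u : Fin (3 * m + r + 1) → S, stairAt f m 1 (wordConfig s r u) = p →
          u (Fin.last _) = p.1 ⟨2 * m - 1, by omega⟩ := by
        rintro u rfl
        simp only [stairAt]
        exact (wordConfig_of_eq s u (by omega) (by omega)).symm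
      simp only [hW, Finset.coe_filter, Set.mem_ofPred_eq, Finset.mem_filter, Finset.mem_univ,
        true_and] at hu hu'
      rw [← Fin.snoc_init_self u, ← Fin.snoc_init_self u', hlast u hu.1, hlast u' hu'.1]
      congr 1
  · intro u hu
    simp only [hW, Finset.coe_filter, Set.mem_ofPred_eq, Finset.mem_univ, true_and] at hu
    simp only [Set.coe_toFinset]
    exact ⟨_, hu, rfl⟩

-- A successor adds one image letter and one configuration letter to `p`; by `hcl` the former
-- determines the latter.
open Classical in
theorem card_leftSuccessors_le [Fintype S] (hm : 0 < m)
    (hcl : ∀ x x' : ℤ → S,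
      stairAt f m 1 x = stairAt f m 1 x' → f x 0 = f x' 0 → x m = x' m)
    (p : (Fin (2 * m) → S) × (Fin (2 * m) → S)) :
    (leftSuccessors f m p).toFinset.card ≤ Fintype.card S := by
  rw [← Finset.card_univ]
  refine Finset.card_le_card_of_injOn (fun q => q.2 ⟨0, by omega⟩)
    (fun _ _ => Finset.mem_coe.2 (Finset.mem_univ _)) ?_
  intro q hq q' hq' h
  rw [Set.coe_toFinset] at hq hq'
  obtain ⟨x, hx, rfl⟩ := hq
  obtain ⟨x', hx', rfl⟩ := hq'
  have hst := hx.trans hx'.symm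
  have h0 : f x 0 = f x' 0 := by simpa [stairAt] using h
  refine Prod.ext (funext fun j => ?_) (funext fun j => ?_)
  · obtain ⟨j, hj⟩ := j
    cases j with
    | zero => simpa [stairAt] using hcl x x' hst h0
    | succ j =>
      have := congrFun (congrArg Prod.fst hst) ⟨j, by omega⟩
      simp only [stairAt] at this ⊢
      rwa [show (1 : ℤ) + m + (j : ℤ) = 0 + m + ((j + 1 : ℕ) : ℤ) by push_cast; ring] at this
  · obtain ⟨j, hj⟩ := j
    cases j with
    | zero => simpa [stairAt] using h0
    | succ j =>
      have := congrFun (congrArg Prod.snd hst) ⟨j, by omega⟩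
      simp only [stairAt] at this ⊢
      rwa [show (1 : ℤ) + (j : ℤ) = 0 + ((j + 1 : ℕ) : ℤ) by push_cast; ring] at this

/-! ### Equality of all stair weights -/

/-- A maximal stair weight is inherited by all left successors. -/
theorem HasRadius.stairWeight_eq_of_mem_leftSuccessors [Fintype S] (hr : HasRadius f r)
    (hm : r < m) (s : S)
    (hcl : ∀ x x' : ℤ → S,
      stairAt f m 1 x = stairAt f m 1 x' → f x 0 = f x' 0 → x m = x' m)
    {p q : (Fin (2 * m) → S) × (Fin (2 * m) → S)}
    (hp : ∀ q, stairWeight f s r m q ≤ stairWeight f s r m p) (hq : q ∈ leftSuccessors f m p) :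
    stairWeight f s r m q = stairWeight f s r m p := by
  classical
  refine le_antisymm (hp q) (not_lt.1 fun hlt => ?_)
  have h₁ := hr.card_mul_stairWeight_le hm s p
  have h₂ : ∑ q ∈ (leftSuccessors f m p).toFinset, stairWeight f s r m q <
      ∑ _q ∈ (leftSuccessors f m p).toFinset, stairWeight f s r m p :=
    Finset.sum_lt_sum (fun q _ => hp q) ⟨q, by simpa using hq, hlt⟩
  have h₃ := Nat.mul_le_mul_right (stairWeight f s r m p)
    (card_leftSuccessors_le (by omega) hcl p)
  rw [Finset.sum_const, smul_eq_mul] at h₂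
  omega

/-- Any two stairs occur together in one configuration. -/
theorem HasRadius.exists_stairAt_eq (hr : HasRadius f r) (hm : r ≤ m) (x x' : ℤ → S) :
    ∃ y, stairAt f m 0 y = stairAt f m 0 x ∧
      stairAt f m (-((3 * m + r : ℕ) : ℤ)) y = stairAt f m 0 x' := by
  -- The two stairs depend on the adjacent windows `[-r, 3m)` and `[-3m - 2r, -r)`, so the splice is
  -- free.
  refine ⟨fun j => if j < -(r : ℤ) then x' (j + (3 * m + r : ℕ)) else x j,
    hr.stairAt_congr hm fun t h₁ h₂ => ?_, hr.stairAt_congr hm fun t h₁ h₂ => ?_⟩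
  · rw [if_neg (by omega)]
  · rw [if_pos (by push_cast; omega)]
    congr 1
    ring

/-- Walking left cell by cell through a configuration containing both stairs, each stair is a left
successor of the previous one, so maximality propagates. -/
theorem HasRadius.stairWeight_eq_of_forall_le [Fintype S] (hr : HasRadius f r)
    (hm : r < m) (s : S)
    (hcl : ∀ x x' : ℤ → S,
      stairAt f m 1 x = stairAt f m 1 x' → f x 0 = f x' 0 → x m = x' m)
    {x : ℤ → S} (hx : ∀ q, stairWeight f s r m q ≤ stairWeight f s r m (stairAt f m 0 x))
    (x' : ℤ → S) :
    stairWeight f s r m (stairAt f m 0 x') = stairWeight f s r m (stairAt f m 0 x) := by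
  obtain ⟨y, hy, hy'⟩ := hr.exists_stairAt_eq hm.le x x'
  rw [← hy']
  generalize 3 * m + r = n
  induction n with
  | zero => simp [hy]
  | succ n ih =>
    rw [← ih]
    refine hr.stairWeight_eq_of_mem_leftSuccessors hm s hcl (fun q => ih ▸ hx q)
      ⟨fun j => y (j + (-((n + 1 : ℕ) : ℤ))), ?_, ?_⟩
    · rw [hr.stairAt_shift]
      congr 1
      push_cast
      ring
    · rw [hr.stairAt_shift, zero_add]

open Classical in
theorem sum_stairWeight [Fintype S] (s : S) :
    ∑ p ∈ (Set.range (stairAt f m 0)).toFinset, stairWeight f s r m p =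
      Fintype.card S ^ (3 * m + r) := by
  have := Finset.card_eq_sum_card_fiberwise (s := (Finset.univ : Finset (Fin (3 * m + r) → S)))
    (f := fun u => stairAt f m 0 (wordConfig s r u))
    (t := (Set.range (stairAt f m 0)).toFinset) (fun u _ => by simp)
  rw [Finset.card_univ, Fintype.card_fun, Fintype.card_fin] at this
  exact this.symm

open Classical in
theorem exists_forall_stairWeight_le [Fintype S] (s : S) :
    ∃ x : ℤ → S, ∀ q, stairWeight f s r m q ≤ stairWeight f s r m (stairAt f m 0 x) := by
  obtain ⟨p, hp, hmax⟩ := Finset.exists_max_image (Set.range (stairAt f m 0)).toFinset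
    (stairWeight f s r m) ⟨stairAt f m 0 fun _ => s, by simp⟩
  simp only [Set.mem_toFinset, Set.mem_range] at hp hmax
  obtain ⟨x, rfl⟩ := hp
  refine ⟨x, fun q => ?_⟩
  by_cases hq : ∃ y, stairAt f m 0 y = q
  · exact hmax q hq
  · have : stairWeight f s r m q = 0 := by
      rw [stairWeight, Finset.card_eq_zero, Finset.filter_eq_empty_iff]
      exact fun u _ hu => hq ⟨_, hu⟩
    omega

end Stairs

theorem mainTheorem12 {S : Type*} [Finite S] (f : (ℤ → S) → (ℤ → S))
    (hf : IsCellularAutomaton f) (hlc : IsLeftClosing f) :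
    ∃ M : ℕ, ∀ m : ℕ, M ≤ m → ∃ k : ℕ, (rightStairs f m).ncard ∣ Nat.card S ^ k := by
  classical
  obtain ⟨r, hr⟩ := hf.exists_hasRadius
  obtain ⟨M, hM⟩ := hr.exists_uniform_closing hlc
  refine ⟨max M (r + 1), fun m hm => ?_⟩
  have hMm : M ≤ m := le_trans (le_max_left _ _) hm
  have hrm : r < m := le_trans (le_max_right _ _) hm
  rw [hr.rightStairs_eq_range]
  let _ := Fintype.ofFinite S
  rcases isEmpty_or_nonempty S with hS | ⟨⟨s⟩⟩
  -- Both cardinalities are 0 here, so the exponent must be positive.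
  · exact ⟨1, by simp⟩
  · obtain ⟨x, hx⟩ := exists_forall_stairWeight_le (f := f) (r := r) (m := m) s
    refine ⟨3 * m + r, stairWeight f s r m (stairAt f m 0 x), ?_⟩
    rw [Nat.card_eq_fintype_card, ← sum_stairWeight (f := f) s,
      Set.ncard_eq_toFinset_card']
    refine Finset.sum_const_nat fun p hp => ?_
    obtain ⟨x', rfl⟩ := Set.mem_toFinset.1 hp
    exact hr.stairWeight_eq_of_forall_le hrm s (hM m hMm) hx x'
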